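/- Let $\mathcal U$ be a finite-dimensional complex Hilbert space, let $\mathbb D$ be the open unit disc of $\mathbb C$, and write $\mathrm{Re}\,A=\tfrac12(A+A^*)$ for $A\in\mathcal L(\mathcal U)$. Let $\mathfrak C(\mathcal U)$ be the Carathéodory class, consisting of the holomorphic functions $F:\mathbb D\to\mathcal L(\mathcal U)$ with $\mathrm{Re}\,F(\lambda)\ge 0$ for all $\lambda\in\mathbb D$. Let $\mathfrak C_\circ(\mathcal U)$ be the set of those $F\in\mathfrak C(\mathcal U)$ for which there is a $\rho>0$ with $\mathrm{Re}\,F(\lambda)\ge\rho I$ for all $\lambda\in\mathbb D$, and let $H^\infty(\mathcal U)$ be the set of bounded holomorphic functions $\mathbb D\to\mathcal L(\mathcal U)$. For $G\in\mathfrak C(\mathcal U)$ let $\mathfrak R_G:=(\ker \mathrm{Re}\,G(\lambda))^\perp$ be the support subspace of $\mathrm{Re}\,G(\lambda)$, which does not depend on $\lambda\in\mathbb D$. For $F,G\in\mathfrak C(\mathcal U)$ write $F\prec_{\mathfrak C}G$ if $$F(\lambda)-G(\lambda)=(\mathrm{Re}\,G(\lambda))^{1/2}\,Q(\lambda)\,(\mathrm{Re}\,G(\lambda))^{1/2}\qquad(\lambda\in\mathbb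 D)$$ for some bounded function $Q:\mathbb D\to\mathcal L(\mathfrak R_G)$. This is a pre-order; write $F\sim_{\mathfrak C}G$ for the associated equivalence relation: $F\prec_{\mathfrak C}G$ and $G\prec_{\mathfrak C}F$. Then the set $\mathfrak C_\circ(\mathcal U)\cap H^\infty(\mathcal U)$ is an equivalence class of $\sim_{\mathfrak C}$ in $\mathfrak C(\mathcal U)$; that is, it is non-empty, and for every $G$ in it, the set of all $F\in\mathfrak C(\mathcal U)$ with $F\sim_{\mathfrak C}G$ is exactly $\mathfrak C_\circ(\mathcal U)\cap H^\infty(\mathcal U)$. Moreover, $F\prec_{\mathfrak C}G$ for every $F\in\mathfrak C(\mathcal U)\cap H^\infty(\mathcal U)$ and every $G\in\mathfrak C_\circ(\mathcal U)\cap H^\infty(\mathcal U)$. -/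

import Mathlib

noncomputable section

namespace CaratheodoryClass

variable {U : Type*} [NormedAddCommGroup U] [InnerProductSpace ℂ U] [CompleteSpace U]

/-- The open unit disc of the complex plane. -/
def disc : Set ℂ := Metric.ball 0 1

/-- The real part `Re A = (A + A*) / 2` of a bounded operator. -/
def reOp (A : U →L[ℂ] U) : U →L[ℂ] U :=
  (1 / 2 : ℂ) • (A + ContinuousLinearMap.adjoint A)

/-- The positive square root `(Re A) ^ (1/2)`; it is used for positive real `A` only. -/
def sqrtRe (A : U →L[ℂ] U) : U →L[ℂ] U := CFC.sqrt (reOp A)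

/-- The positive real operators: `Re A ≥ 0`, in the Loewner order. -/
def PR (U : Type*) [NormedAddCommGroup U] [InnerProductSpace ℂ U] [CompleteSpace U] :
    Set (U →L[ℂ] U) :=
  {A | 0 ≤ reOp A}

/-- The support subspace of `Re A`, the orthogonal complement of its kernel. -/
def supportRe (A : U →L[ℂ] U) : Submodule ℂ U := (LinearMap.ker (reOp A).toLinearMap)ᗮ

/-- The Carathéodory class: `PR U`-valued holomorphic functions on the disc. A function on the
disc is represented by a function on `ℂ` whose values off the disc are never used. -/
def Cara (U : Type*) [NormedAddCommGroup U] [InnerProductSpace ℂ U] [CompleteSpace U] :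
    Set (ℂ → U →L[ℂ] U) :=
  {F | DifferentiableOn ℂ F disc ∧ ∀ z ∈ disc, F z ∈ PR U}

/-- The strict Carathéodory class: `Re F(z) ≥ ρ I` on the disc for one `ρ > 0`. -/
def StrictCara (U : Type*) [NormedAddCommGroup U] [InnerProductSpace ℂ U] [CompleteSpace U] :
    Set (ℂ → U →L[ℂ] U) :=
  {F | F ∈ Cara U ∧ ∃ ρ : ℝ, 0 < ρ ∧
    ∀ z ∈ disc, (ρ : ℂ) • ContinuousLinearMap.id ℂ U ≤ reOp (F z)}

/-- The Hardy class of bounded holomorphic operator-valued functions on the disc. -/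
def HInfty (U : Type*) [NormedAddCommGroup U] [InnerProductSpace ℂ U] [CompleteSpace U] :
    Set (ℂ → U →L[ℂ] U) :=
  {F | DifferentiableOn ℂ F disc ∧ ∃ C : ℝ, ∀ z ∈ disc, ‖F z‖ ≤ C}

/-- The pre-order on the Carathéodory class: on the disc,
`F - G = (Re G) ^ (1/2) Q (Re G) ^ (1/2)` for a bounded function `Q` whose values are operators
on the support subspace of `Re G`. For `G` in the Carathéodory class this subspace is the same at
all points of the disc. The inner `(Re G) ^ (1/2)` has its range in the support, so the orthogonal
projection only restricts the codomain. -/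
def PrecC [FiniteDimensional ℂ U] (F G : ℂ → U →L[ℂ] U) : Prop :=
  ∃ Q : (z : ℂ) → (supportRe (G z) →L[ℂ] supportRe (G z)),
    (∃ C : ℝ, ∀ z ∈ disc, ‖Q z‖ ≤ C) ∧
    ∀ z ∈ disc, F z - G z =
      sqrtRe (G z) ∘L (supportRe (G z)).subtypeL ∘L Q z ∘L
        (supportRe (G z)).orthogonalProjectionOnto ∘L sqrtRe (G z)

/-- The equivalence relation associated with the pre-order. -/
def SimC [FiniteDimensional ℂ U] (F G : ℂ → U →L[ℂ] U) : Prop :=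
  PrecC F G ∧ PrecC G F

end CaratheodoryClass

end

/-!
For positive real `A` the square root satisfies `‖(Re A)^(1/2) x‖² = Re ⟪A x, x⟫`
(`norm_sqrtRe_apply_sq`), so every condition in sight is one on the quadratic form `Re ⟪A x, x⟫`.

* If `F ≺ G` with `Q` as in the definition, and `‖Q‖` denotes its supremum over the disc, then
  `‖F - G‖ ≤ ‖Q‖ ‖G‖`, so `F` inherits boundedness from `G`
  (`PrecC.mem_HInfty`); and `Re ⟪(F - G) x, x⟫ ≤ ‖Q‖ Re ⟪G x, x⟫`, that is,
  `Re F ≤ (1 + ‖Q‖) Re G`, so `G` inherits a uniform positive lower bound from `F`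
  (`PrecC.mem_StrictCara`). An `F` equivalent to a bounded strict `G` is thus bounded and strict.
* If `Re G ≥ ρ I` with `ρ > 0`, then `(Re G)^(1/2)` is invertible with inverse of norm at most
  `ρ^(-1/2)`, the support subspace is everything, and
  `Q = (Re G)^(-1/2) (F - G) (Re G)^(-1/2)` is bounded whenever `F` and `G` are
  (`precC_of_mem_HInfty`). Bounded strict functions are thus pairwise equivalent.
-/

namespace CaratheodoryClass

open scoped InnerProductSpace

variable {U : Type*} [NormedAddCommGroup U] [InnerProductSpace ℂ U] [CompleteSpace U]

/-! ### The real part and its square root as quadratic forms -/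

theorem isSelfAdjoint_reOp (A : U →L[ℂ] U) : IsSelfAdjoint (reOp A) := by
  rw [isSelfAdjoint_iff, reOp, star_smul, star_add, ContinuousLinearMap.star_eq_adjoint,
    ContinuousLinearMap.star_eq_adjoint, ContinuousLinearMap.adjoint_adjoint, add_comm]
  simp

theorem re_inner_reOp (A : U →L[ℂ] U) (x : U) :
    (⟪reOp A x, x⟫_ℂ).re = (⟪A x, x⟫_ℂ).re := by
  have h : (⟪x, A x⟫_ℂ).re = (⟪A x, x⟫_ℂ).re := inner_re_symm (𝕜 := ℂ) x (A x)
  have h2 : ⟪reOp A x, x⟫_ℂ = (1 / 2 : ℂ) * (⟪A x, x⟫_ℂ + ⟪x, A x⟫_ℂ) := by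
    simp [reOp, ContinuousLinearMap.adjoint_inner_left]
    ring
  rw [h2, show (1 / 2 : ℂ) = ((1 / 2 : ℝ) : ℂ) by norm_num, Complex.re_ofReal_mul,
    Complex.add_re, h]
  ring

theorem smul_id_le_reOp_iff (A : U →L[ℂ] U) (ρ : ℝ) :
    (ρ : ℂ) • ContinuousLinearMap.id ℂ U ≤ reOp A ↔
      ∀ x, ρ * ‖x‖ ^ 2 ≤ (⟪A x, x⟫_ℂ).re := by
  have hsa : IsSelfAdjoint (reOp A - (ρ : ℂ) • ContinuousLinearMap.id ℂ U) := by
    refine (isSelfAdjoint_reOp A).sub (IsSelfAdjoint.smul ?_ (IsSelfAdjoint.one (U →L[ℂ] U)))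
    exact Complex.conj_ofReal ρ
  have key (x : U) : (reOp A - (ρ : ℂ) • ContinuousLinearMap.id ℂ U).reApplyInnerSelf x =
      (⟪A x, x⟫_ℂ).re - ρ * ‖x‖ ^ 2 := by
    have h : (⟪x, x⟫_ℂ).re = ‖x‖ ^ 2 := (norm_sq_eq_re_inner (𝕜 := ℂ) x).symm
    rw [ContinuousLinearMap.reApplyInnerSelf_apply, ← re_inner_reOp, ← h]
    change (⟪reOp A x - (ρ : ℂ) • x, x⟫_ℂ).re = _
    rw [inner_sub_left, inner_smul_left, Complex.conj_ofReal, Complex.sub_re,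
      Complex.re_ofReal_mul]
  rw [ContinuousLinearMap.le_def, ContinuousLinearMap.isPositive_def']
  simp only [key, sub_nonneg, hsa, true_and]

theorem sqrtRe_mul_self {A : U →L[ℂ] U} (hA : A ∈ PR U) : sqrtRe A * sqrtRe A = reOp A :=
  CFC.sqrt_mul_sqrt_self (reOp A) hA

theorem adjoint_sqrtRe (A : U →L[ℂ] U) :
    ContinuousLinearMap.adjoint (sqrtRe A) = sqrtRe A :=
  (CFC.sqrt_nonneg (reOp A)).isSelfAdjoint

theorem inner_sqrtRe_left (A : U →L[ℂ] U) (x y : U) :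
    ⟪sqrtRe A x, y⟫_ℂ = ⟪x, sqrtRe A y⟫_ℂ := by
  rw [← ContinuousLinearMap.adjoint_inner_right, adjoint_sqrtRe]

theorem norm_sqrtRe_apply_sq {A : U →L[ℂ] U} (hA : A ∈ PR U) (x : U) :
    ‖sqrtRe A x‖ ^ 2 = (⟪A x, x⟫_ℂ).re := by
  rw [← re_inner_reOp, ← sqrtRe_mul_self hA, mul_apply_eq_comp, inner_sqrtRe_left]
  exact norm_sq_eq_re_inner (𝕜 := ℂ) _

theorem norm_sqrtRe_mul_self_le {A : U →L[ℂ] U} (hA : A ∈ PR U) :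
    ‖sqrtRe A‖ * ‖sqrtRe A‖ ≤ ‖A‖ := by
  have h : ‖sqrtRe A‖ ≤ √‖A‖ := by
    refine ContinuousLinearMap.opNorm_le_bound _ (Real.sqrt_nonneg _) fun x => ?_
    refine abs_le_of_sq_le_sq' ?_ (by positivity) |>.2
    rw [norm_sqrtRe_apply_sq hA, mul_pow, Real.sq_sqrt (norm_nonneg _)]
    calc (⟪A x, x⟫_ℂ).re ≤ ‖A x‖ * ‖x‖ := re_inner_le_norm (𝕜 := ℂ) _ _
      _ ≤ ‖A‖ * ‖x‖ * ‖x‖ := by gcongr; exact A.le_opNorm x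
      _ = ‖A‖ * ‖x‖ ^ 2 := by ring
  calc ‖sqrtRe A‖ * ‖sqrtRe A‖ ≤ √‖A‖ * √‖A‖ := by gcongr
    _ = ‖A‖ := Real.mul_self_sqrt (norm_nonneg _)

/-! ### Consequences of the pre-order -/

/-- On the disc, `F ≺ G` gives `F = G + S K S` with `S = (Re G)^(1/2)` and a bounded `K` that acts
on all of `U`: extend `Q` by zero to the kernel of `Re G`. -/
theorem PrecC.exists_bounded_middle [FiniteDimensional ℂ U] {F G : ℂ → U →L[ℂ] U}
    (h : PrecC F G) : ∃ C : ℝ, 0 ≤ C ∧ ∀ z ∈ disc, ∃ K : U →L[ℂ] U, ‖K‖ ≤ C ∧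
      F z = G z + sqrtRe (G z) ∘L K ∘L sqrtRe (G z) := by
  obtain ⟨Q, ⟨C, hC⟩, hQ⟩ := h
  refine ⟨max C 0, le_max_right _ _, fun z hz =>
    ⟨(supportRe (G z)).subtypeL ∘L Q z ∘L (supportRe (G z)).orthogonalProjectionOnto, ?_, ?_⟩⟩
  · refine ContinuousLinearMap.opNorm_le_bound _ (le_max_right _ _) fun x => ?_
    calc ‖Q z ((supportRe (G z)).orthogonalProjectionOnto x)‖
        ≤ ‖Q z‖ * ‖(supportRe (G z)).orthogonalProjectionOnto x‖ := (Q z).le_opNorm _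
      _ ≤ max C 0 * ‖x‖ := by
        gcongr
        · exact (hC z hz).trans (le_max_left _ _)
        · exact Submodule.norm_orthogonalProjectionOnto_apply_le _ x
  · exact (sub_eq_iff_eq_add'.1 (hQ z hz))

theorem PrecC.mem_HInfty [FiniteDimensional ℂ U] {F G : ℂ → U →L[ℂ] U} (h : PrecC F G)
    (hF : F ∈ Cara U) (hG : G ∈ Cara U ∩ HInfty U) : F ∈ HInfty U := by
  obtain ⟨C, hC0, hC⟩ := h.exists_bounded_middle
  obtain ⟨M, hM⟩ := hG.2.2
  refine ⟨hF.1, M + C * M, fun z hz => ?_⟩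
  obtain ⟨K, hK, hFz⟩ := hC z hz
  set S := sqrtRe (G z)
  have hS : ‖S‖ * ‖S‖ ≤ M := (norm_sqrtRe_mul_self_le (hG.1.2 z hz)).trans (hM z hz)
  calc ‖F z‖ ≤ ‖G z‖ + ‖S ∘L K ∘L S‖ := by rw [hFz]; exact norm_add_le _ _
    _ ≤ M + ‖S‖ * (‖K‖ * ‖S‖) := by
      gcongr
      · exact hM z hz
      · exact (S.opNorm_comp_le _).trans (by gcongr; exact K.opNorm_comp_le _)
    _ = M + ‖K‖ * (‖S‖ * ‖S‖) := by ring
    _ ≤ M + C * M := by gcongr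

theorem PrecC.mem_StrictCara [FiniteDimensional ℂ U] {F G : ℂ → U →L[ℂ] U} (h : PrecC F G)
    (hF : F ∈ StrictCara U) (hG : G ∈ Cara U) : G ∈ StrictCara U := by
  obtain ⟨C, hC0, hC⟩ := h.exists_bounded_middle
  obtain ⟨-, ρ, hρ, hFρ⟩ := hF
  refine ⟨hG, ρ / (1 + C), by positivity, fun z hz => ?_⟩
  rw [smul_id_le_reOp_iff]
  intro x
  obtain ⟨K, hK, hFz⟩ := hC z hz
  have hlow := (smul_id_le_reOp_iff _ _).1 (hFρ z hz) x
  have hsq := norm_sqrtRe_apply_sq (hG.2 z hz) x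
  set S := sqrtRe (G z) with hS
  have hinner : ⟪F z x, x⟫_ℂ = ⟪G z x, x⟫_ℂ + ⟪K (S x), S x⟫_ℂ := by
    rw [hFz, add_apply, inner_add_left, ContinuousLinearMap.comp_apply,
      ContinuousLinearMap.comp_apply, hS, inner_sqrtRe_left]
  have hKS : (⟪K (S x), S x⟫_ℂ).re ≤ C * ‖S x‖ ^ 2 :=
    calc (⟪K (S x), S x⟫_ℂ).re ≤ ‖K (S x)‖ * ‖S x‖ := re_inner_le_norm (𝕜 := ℂ) _ _
      _ ≤ C * ‖S x‖ * ‖S x‖ := by gcongr; exact K.le_of_opNorm_le hK _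
      _ = C * ‖S x‖ ^ 2 := by ring
  rw [hinner, Complex.add_re] at hlow
  rw [div_mul_eq_mul_div, div_le_iff₀ (by positivity)]
  rw [hsq] at hKS
  linarith

/-! ### Domination by bounded strict functions -/

/-- If `Re A ≥ ρ I` with `ρ > 0`, every operator `B` factors through `(Re A)^(1/2)` on both sides,
with a middle factor of norm at most `‖B‖ / ρ`. -/
theorem exists_factor_sqrtRe [FiniteDimensional ℂ U] {A : U →L[ℂ] U} (hA : A ∈ PR U) {ρ : ℝ}
    (hρ : 0 < ρ) (hAρ : (ρ : ℂ) • ContinuousLinearMap.id ℂ U ≤ reOp A) (B : U →L[ℂ] U) :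
    ∃ Q : supportRe A →L[ℂ] supportRe A, ‖Q‖ ≤ ‖B‖ / ρ ∧
      B = sqrtRe A ∘L (supportRe A).subtypeL ∘L Q ∘L
        (supportRe A).orthogonalProjectionOnto ∘L sqrtRe A := by
  rw [smul_id_le_reOp_iff] at hAρ
  have hpos : 0 < √ρ := Real.sqrt_pos.2 hρ
  have hbelow (x : U) : √ρ * ‖x‖ ≤ ‖sqrtRe A x‖ := by
    refine abs_le_of_sq_le_sq' ?_ (by positivity) |>.2
    rw [norm_sqrtRe_apply_sq hA, mul_pow, Real.sq_sqrt hρ.le]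
    exact hAρ x
  have hzero (x : U) (hx : sqrtRe A x = 0) : x = 0 := by
    have := hbelow x
    rw [hx, norm_zero] at this
    exact norm_le_zero_iff.1 (nonpos_of_mul_nonpos_right this hpos)
  have hsupp : supportRe A = ⊤ := by
    rw [supportRe, Submodule.orthogonal_eq_top_iff, LinearMap.ker_eq_bot']
    intro x hx
    refine hzero x (hzero _ ?_)
    rw [← mul_apply_eq_comp, sqrtRe_mul_self hA]
    exact hx
  have hproj (x : U) : ((supportRe A).orthogonalProjectionOnto x : U) = x :=
    Submodule.starProjection_eq_self_iff.2 (by rw [hsupp]; trivial)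
  let e : U ≃L[ℂ] U := (LinearEquiv.ofInjectiveEndo (sqrtRe A).toLinearMap
    ((injective_iff_map_eq_zero _).2 hzero)).toContinuousLinearEquiv
  have he (x : U) : e x = sqrtRe A x := rfl
  have hR (x : U) : ‖e.symm x‖ ≤ ‖x‖ / √ρ := by
    rw [le_div_iff₀' hpos]
    simpa [← he] using hbelow (e.symm x)
  refine ⟨(supportRe A).orthogonalProjectionOnto ∘L (e.symm : U →L[ℂ] U) ∘L B ∘L
    (e.symm : U →L[ℂ] U) ∘L (supportRe A).subtypeL, ?_, ?_⟩
  · refine ContinuousLinearMap.opNorm_le_bound _ (by positivity) fun x => ?_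
    calc ‖(supportRe A).orthogonalProjectionOnto (e.symm (B (e.symm (x : U))))‖
        ≤ ‖e.symm (B (e.symm (x : U)))‖ :=
          Submodule.norm_orthogonalProjectionOnto_apply_le _ _
      _ ≤ ‖B (e.symm (x : U))‖ / √ρ := hR _
      _ ≤ ‖B‖ * (‖(x : U)‖ / √ρ) / √ρ := by
        gcongr
        exact (B.le_opNorm _).trans (by gcongr; exact hR _)
      _ = ‖B‖ / (√ρ * √ρ) * ‖x‖ := by
        rw [Submodule.coe_norm]
        field_simp
      _ = ‖B‖ / ρ * ‖x‖ := by rw [Real.mul_self_sqrt hρ.le]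
  · ext x
    simp only [ContinuousLinearMap.comp_apply, Submodule.subtypeL_apply, hproj,
      ContinuousLinearEquiv.coe_coe, ← he, e.symm_apply_apply, e.apply_symm_apply]

theorem precC_of_mem_HInfty [FiniteDimensional ℂ U] {F G : ℂ → U →L[ℂ] U} (hF : F ∈ HInfty U)
    (hG : G ∈ StrictCara U ∩ HInfty U) : PrecC F G := by
  obtain ⟨-, M, hM⟩ := hF
  obtain ⟨⟨hGc, ρ, hρ, hGρ⟩, -, N, hN⟩ := hG
  have hex : ∀ z, ∃ Q : supportRe (G z) →L[ℂ] supportRe (G z), z ∈ disc →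
      ‖Q‖ ≤ ‖F z - G z‖ / ρ ∧ F z - G z =
        sqrtRe (G z) ∘L (supportRe (G z)).subtypeL ∘L Q ∘L
          (supportRe (G z)).orthogonalProjectionOnto ∘L sqrtRe (G z) := by
    intro z
    by_cases hz : z ∈ disc
    · obtain ⟨Q, hQ⟩ := exists_factor_sqrtRe (hGc.2 z hz) hρ (hGρ z hz) (F z - G z)
      exact ⟨Q, fun _ => hQ⟩
    · exact ⟨0, fun h => absurd h hz⟩
  choose Q hQ using hex
  refine ⟨Q, ⟨(M + N) / ρ, fun z hz => (hQ z hz).1.trans ?_⟩, fun z hz => (hQ z hz).2⟩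
  gcongr
  exact (norm_sub_le _ _).trans (add_le_add (hM z hz) (hN z hz))

/-- The constant function `I` is a bounded strict Carathéodory function. -/
theorem const_id_mem : (fun _ => ContinuousLinearMap.id ℂ U) ∈ StrictCara U ∩ HInfty U := by
  have hnorm (x : U) : (⟪x, x⟫_ℂ).re = ‖x‖ ^ 2 := (norm_sq_eq_re_inner (𝕜 := ℂ) x).symm
  have hd : DifferentiableOn ℂ (fun _ : ℂ => ContinuousLinearMap.id ℂ U) disc :=
    differentiableOn_const _
  refine ⟨⟨⟨hd, fun z _ => ?_⟩, 1, one_pos, fun z _ => ?_⟩, hd, _, fun z _ => le_rfl⟩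
  · have := (smul_id_le_reOp_iff (ContinuousLinearMap.id ℂ U) 0).2 fun x => by
      rw [ContinuousLinearMap.id_apply, hnorm, zero_mul]
      positivity
    simpa [PR] using this
  · exact (smul_id_le_reOp_iff _ _).2 fun x => by
      rw [ContinuousLinearMap.id_apply, hnorm, one_mul]

end CaratheodoryClass

theorem corollary3p3 (U : Type*) [NormedAddCommGroup U] [InnerProductSpace ℂ U]
    [CompleteSpace U] [FiniteDimensional ℂ U] :
    ((CaratheodoryClass.StrictCara U ∩ CaratheodoryClass.HInfty U).Nonempty ∧
      ∀ G ∈ CaratheodoryClass.StrictCara U ∩ CaratheodoryClass.HInfty U,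
        {F ∈ CaratheodoryClass.Cara U | CaratheodoryClass.SimC F G} =
          CaratheodoryClass.StrictCara U ∩ CaratheodoryClass.HInfty U) ∧
    ∀ F ∈ CaratheodoryClass.Cara U ∩ CaratheodoryClass.HInfty U,
      ∀ G ∈ CaratheodoryClass.StrictCara U ∩ CaratheodoryClass.HInfty U,
        CaratheodoryClass.PrecC F G := by
  open CaratheodoryClass in
  refine ⟨⟨⟨_, const_id_mem⟩, fun G hG => Set.ext fun F => ⟨?_, fun hF => ?_⟩⟩,
    fun F hF G hG => precC_of_mem_HInfty hF.2 hG⟩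
  · rintro ⟨hF, hFG, hGF⟩
    exact ⟨hGF.mem_StrictCara hG.1 hF, hFG.mem_HInfty hF ⟨hG.1.1, hG.2⟩⟩
  · exact ⟨hF.1.1, precC_of_mem_HInfty hF.2 hG, precC_of_mem_HInfty hG.2 hF⟩
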